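/- All groups are finite; a class of groups is a collection of finite groups closed under isomorphism, and $\pi(G)$ is the set of primes dividing $|G|$. The Sylow graph $\Gamma_s(G)$ of a group $G$ is the directed graph with vertex set $\pi(G)$ in which $(p,q)$ is an edge if and only if $q\in\pi(N_G(P)/PC_G(P))$ for a Sylow $p$-subgroup $P$ of $G$. For a class of groups $\mathfrak{X}$ put $\Gamma_s(\mathfrak{X})=\bigcup_{G\in\mathfrak{X}}\Gamma_s(G)$ (union of vertex sets and of edge sets), $\pi(\mathfrak{X})=\bigcup_{G\in\mathfrak{X}}\pi(G)$, and let $\mathfrak{X}_{\Gamma_s}$ be the class of all groups $G$ such that $\Gamma_s(G)$ is a subgraph of $\Gamma_s(\mathfrak{X})$. A directed graph is called undirected if $(p,q)$ is an edge whenever $(q,p)$ is. Let $\mathfrak{S}$ be the class of soluble groups and, for a set $\pi$ of primes, $\mathfrak{S}_\pi$ the class of soluble groups $G$ with $\pi(G)\subseteq\pi$. A formation is a (possibly empty) class of groups $\mathfrak{F}$ that is closed under epimorphic images and such that $G\in\mathfrak{F}$ whenever $N_1,\dots,N_n$ ($n\ge 1$) are normal subgroups of $G$ with $\bigcap_i N_i=1$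 and $G/N_i\in\mathfrak{F}$ for all $i$. It is hereditary if it is closed under subgroups, and saturated if $G/\Phi(G)\in\mathfrak{F}$ implies $G\in\mathfrak{F}$, where $\Phi(G)$ is the Frattini subgroup. For a function $F$ assigning a formation $F(p)$ to every prime $p$, let $LF(F)$ be the class of all groups $G$ such that $G/C_G(H/K)\in F(p)$ for every chief factor $H/K$ of $G$ and every prime $p\in\pi(H/K)$. A class $\mathfrak{F}$ is a covering formation if $\mathfrak{F}=LF(F)$ for such a function $F$ with: $F(p)=\mathfrak{S}_{\pi(F(p))}$ and $p\in\pi(F(p))$ for all $p\in\pi(\mathfrak{F})$; $F(p)=\emptyset$ for all primes $p\notin\pi(\mathfrak{F})$; and, for all primes $p,q$, $p\in\pi(F(q))$ implies $q\in\pi(F(p))$. Theorem. Let $\mathfrak{X}$ be a class of groups such that $\Gamma_s(\mathfrak{X})$ is undirected. Then $\mathfrak{X}_{\Gamma_s}\cap\mathfrak{S}$ is a covering formation (of soluble groups). In particular, $\mathfrak{X}_{\Gamma_s}\cap\mathfrak{S}$ is a hereditary saturated formation. -/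

import Mathlib

universe u

/-- `π(α)`: the set of prime divisors of the order of a finite group, coset space, ... -/
def primesOf (α : Type*) : Set ℕ := {p | p ∈ (Nat.card α).primeFactors}

/-- A directed graph: a set of vertices (here natural numbers) and a set of ordered pairs of
vertices, the edges. -/
structure PrimeGraph where
  /-- the vertices -/
  V : Set ℕ
  /-- the edges -/
  E : Set (ℕ × ℕ)
  left_mem : ∀ e ∈ E, e.1 ∈ V
  right_mem : ∀ e ∈ E, e.2 ∈ V

namespace PrimeGraph

/-- `Γ` is a subgraph of `Δ`. -/
def IsSubgraph (Γ Δ : PrimeGraph) : Prop := Γ.V ⊆ Δ.V ∧ Γ.E ⊆ Δ.E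

/-- `Γ` is undirected. -/
def IsUndirected (Γ : PrimeGraph) : Prop := ∀ p q : ℕ, (p, q) ∈ Γ.E ↔ (q, p) ∈ Γ.E

end PrimeGraph

/-- The subgroup `P C_G(P)` (normal in `N_G(P)`). -/
def mulCentralizer {G : Type*} [Group G] (P : Subgroup G) : Subgroup G :=
  P ⊔ Subgroup.centralizer (P : Set G)

/-- The set of cosets of `P C_G(P)` in `N_G(P)`, i.e. the underlying set of
`N_G(P) / P C_G(P)`. -/
abbrev OuterAutomizer {G : Type*} [Group G] (P : Subgroup G) : Type _ :=
  Subgroup.normalizer (P : Set G) ⧸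
    (mulCentralizer P).subgroupOf (Subgroup.normalizer (P : Set G))

theorem primesOf_subset_of_dvd {α β : Type*} [Finite β] [Nonempty β]
    (h : Nat.card α ∣ Nat.card β) : primesOf α ⊆ primesOf β := fun _ hp =>
  Nat.primeFactors_mono h Nat.card_pos.ne' hp

theorem primesOf_congr {α β : Type*} (e : α ≃ β) : primesOf α = primesOf β := by
  simp only [primesOf, Nat.card_congr e]

/-- The Sylow graph `Γ_s(G)` of a finite group `G`: the vertices are the primes dividing `|G|`, and
`(p, q)` is an edge iff `q ∈ π(N_G(P) / P C_G(P))` for a Sylow `p`-subgroup `P` of `G`. -/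
def sylowGraph (G : Type*) [Group G] [Finite G] : PrimeGraph where
  V := primesOf G
  E := {e | e.1 ∈ primesOf G ∧
    ∃ P : Sylow e.1 G, e.2 ∈ primesOf (OuterAutomizer (P : Subgroup G))}
  left_mem _ h := h.1
  right_mem := by
    rintro e ⟨-, P, h⟩
    exact primesOf_subset_of_dvd
      ((Subgroup.card_quotient_dvd_card _).trans (Subgroup.card_subgroup_dvd_card _)) h

theorem map_centralizer_equiv {G H : Type*} [Group G] [Group H] (e : G ≃* H)
    (P : Subgroup G) :
    (Subgroup.centralizer (P : Set G)).map e.toMonoidHom =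
      Subgroup.centralizer ((P.map e.toMonoidHom : Subgroup H) : Set H) := by
  ext x
  obtain ⟨x, rfl⟩ := e.surjective x
  simp [Subgroup.mem_centralizer_iff, ← map_mul]

theorem card_outerAutomizer_map {G H : Type*} [Group G] [Group H] (e : G ≃* H)
    (P : Subgroup G) :
    Nat.card (OuterAutomizer (P.map e.toMonoidHom)) = Nat.card (OuterAutomizer P) := by
  have h := Subgroup.relIndex_map_map_of_injective (f := e.toMonoidHom) (mulCentralizer P)
    (Subgroup.normalizer (P : Set G)) e.injective
  have h1 : (Subgroup.normalizer (P : Set G)).map e.toMonoidHom =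
      Subgroup.normalizer ((P.map e.toMonoidHom : Subgroup H) : Set H) :=
    Subgroup.map_equiv_normalizer_eq P e
  have h2 : (mulCentralizer P).map e.toMonoidHom = mulCentralizer (P.map e.toMonoidHom) := by
    simp only [mulCentralizer, Subgroup.map_sup, map_centralizer_equiv]
  rw [h1, h2] at h
  exact h

/-- Isomorphic groups have the same Sylow graph (one inclusion). -/
theorem sylowGraph_isSubgraph_of_equiv {G H : Type*} [Group G] [Group H] [Finite G] [Finite H]
    (e : G ≃* H) : (sylowGraph H).IsSubgraph (sylowGraph G) := by
  have hV : primesOf H = primesOf G := primesOf_congr e.symm.toEquiv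
  refine ⟨hV.le, ?_⟩
  rintro ⟨p, q⟩ ⟨hp, P, hq⟩
  refine ⟨hV ▸ hp, P.comapOfInjective e.toMonoidHom e.injective (fun x _ => ?_), ?_⟩
  · obtain ⟨y, hy⟩ := e.surjective x
    exact ⟨y, hy⟩
  · have h := card_outerAutomizer_map e ((P : Subgroup H).comap e.toMonoidHom)
    rw [Subgroup.map_comap_eq_self_of_surjective e.surjective] at h
    have hq' : q ∈ (Nat.card (OuterAutomizer (P : Subgroup H))).primeFactors := hq
    rw [h] at hq'
    exact hq'

/-- A class of groups: a collection of finite groups closed under isomorphism. -/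
structure GroupClass where
  /-- membership in the class -/
  Mem : ∀ (G : Type u) [Group G], Prop
  finite : ∀ (G : Type u) [Group G], Mem G → Finite G
  iso : ∀ (G H : Type u) [Group G] [Group H], (G ≃* H) → Mem G → Mem H

namespace GroupClass

/-- The empty class. -/
def empty : GroupClass.{u} where
  Mem _ _ := False
  finite _ _ h := h.elim
  iso _ _ _ _ _ h := h

/-- `𝔖`: the class of finite soluble groups. -/
def soluble : GroupClass.{u} where
  Mem G _ := Finite G ∧ Group.IsSolvable G
  finite _ _ h := h.1
  iso _ _ _ _ e h := by
    obtain ⟨_, _⟩ := h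
    exact ⟨Finite.of_equiv _ e.toEquiv, Group.isSolvable_of_surjective (f := e.toMonoidHom) e.surjective⟩

/-- `𝔖_π`: the class of finite soluble `π`-groups. -/
def solublePi (π : Set ℕ) : GroupClass.{u} where
  Mem G _ := soluble.Mem G ∧ primesOf G ⊆ π
  finite _ _ h := soluble.finite _ h.1
  iso _ _ _ _ e h := ⟨soluble.iso _ _ e h.1, primesOf_congr e.symm.toEquiv ▸ h.2⟩

/-- The intersection of two classes. -/
def inter (𝔛 𝔜 : GroupClass.{u}) : GroupClass.{u} where
  Mem G _ := 𝔛.Mem G ∧ 𝔜.Mem G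
  finite _ _ h := 𝔛.finite _ h.1
  iso _ _ _ _ e h := ⟨𝔛.iso _ _ e h.1, 𝔜.iso _ _ e h.2⟩

/-- `π(𝔛)`: the union of the sets `π(G)` for `G` in `𝔛`. -/
def primes (𝔛 : GroupClass.{u}) : Set ℕ :=
  {p | ∃ (G : Type u) (_ : Group G), 𝔛.Mem G ∧ p ∈ primesOf G}

/-- `Γ_s(𝔛)`: the union of the Sylow graphs of the groups in `𝔛`. -/
def sylowGraph (𝔛 : GroupClass.{u}) : PrimeGraph where
  V := {p | ∃ (G : Type u) (_ : Group G) (_ : Finite G), 𝔛.Mem G ∧ p ∈ (_root_.sylowGraph G).V}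
  E := {e | ∃ (G : Type u) (_ : Group G) (_ : Finite G), 𝔛.Mem G ∧ e ∈ (_root_.sylowGraph G).E}
  left_mem := by
    rintro e ⟨G, _, _, hG, he⟩
    exact ⟨G, _, _, hG, (_root_.sylowGraph G).left_mem e he⟩
  right_mem := by
    rintro e ⟨G, _, _, hG, he⟩
    exact ⟨G, _, _, hG, (_root_.sylowGraph G).right_mem e he⟩

/-- `𝔛_{Γ_s}`: the class of all finite groups `G` such that `Γ_s(G)` is a subgraph of `Γ_s(𝔛)`. -/
def sylowClosure (𝔛 : GroupClass.{u}) : GroupClass.{u} where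
  Mem G _ := ∃ _ : Finite G, (_root_.sylowGraph G).IsSubgraph 𝔛.sylowGraph
  finite _ _ h := h.1
  iso _ _ _ _ e h := by
    obtain ⟨_, h⟩ := h
    have hfin := Finite.of_equiv _ e.toEquiv
    have h' := sylowGraph_isSubgraph_of_equiv e
    exact ⟨hfin, h'.1.trans h.1, h'.2.trans h.2⟩

/-- Closure under epimorphic images. -/
def IsQClosed (𝔛 : GroupClass.{u}) : Prop :=
  ∀ (G H : Type u) [Group G] [Group H] (f : G →* H), Function.Surjective f → 𝔛.Mem G → 𝔛.Mem H

/-- Closure under finite subdirect products: if `N₁, …, Nₙ` (`n ≥ 1`) are normal subgroups of the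
finite group `G` with trivial intersection and every `G ⧸ Nᵢ` is in `𝔛`, then so is `G`. -/
def IsR0Closed (𝔛 : GroupClass.{u}) : Prop :=
  ∀ (G : Type u) [Group G] [Finite G] (n : ℕ) (N : Fin (n + 1) → Subgroup G)
    [∀ i, (N i).Normal], (∀ i, 𝔛.Mem (G ⧸ N i)) → ⨅ i, N i = ⊥ → 𝔛.Mem G

/-- A formation: a (possibly empty) class closed under epimorphic images and finite subdirect
products. -/
def IsFormation (𝔛 : GroupClass.{u}) : Prop := 𝔛.IsQClosed ∧ 𝔛.IsR0Closed

/-- Closure under subgroups. -/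
def IsHereditary (𝔛 : GroupClass.{u}) : Prop :=
  ∀ (G : Type u) [Group G] (H : Subgroup G), 𝔛.Mem G → 𝔛.Mem H

/-- Closure under Frattini extensions. -/
def IsSaturated (𝔛 : GroupClass.{u}) : Prop :=
  ∀ (G : Type u) [Group G] [Finite G], 𝔛.Mem (G ⧸ frattini G) → 𝔛.Mem G

end GroupClass

/-- `H / K` is a chief factor of `G`: `K < H` are normal in `G` and no normal subgroup of `G` lies
strictly between them. -/
structure IsChiefFactor {G : Type*} [Group G] (H K : Subgroup G) : Prop where
  normal_top : H.Normal
  normal_bot : K.Normal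
  lt : K < H
  minimal : ∀ N : Subgroup G, N.Normal → K ≤ N → N ≤ H → N = K ∨ N = H

/-- `C_G(H / K)`: the elements of `G` that centralize `H / K`, i.e. the preimage in `G` of the
centralizer of the image of `H` in `G ⧸ K`. -/
def factorCentralizer {G : Type*} [Group G] (H K : Subgroup G) [K.Normal] : Subgroup G :=
  (Subgroup.centralizer
    ((H.map (QuotientGroup.mk' K) : Subgroup (G ⧸ K)) : Set (G ⧸ K))).comap (QuotientGroup.mk' K)

instance factorCentralizer_normal {G : Type*} [Group G] (H K : Subgroup G) [H.Normal] [K.Normal] :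
    (factorCentralizer H K).Normal := by
  have : (H.map (QuotientGroup.mk' K)).Normal :=
    Subgroup.Normal.map ‹H.Normal› _ (QuotientGroup.mk'_surjective K)
  unfold factorCentralizer
  infer_instance

theorem mem_factorCentralizer_iff {G : Type*} [Group G] (H K : Subgroup G) [K.Normal] (g : G) :
    g ∈ factorCentralizer H K ↔ ∀ h ∈ H, (h * g)⁻¹ * (g * h) ∈ K := by
  simp only [factorCentralizer, Subgroup.mem_comap, Subgroup.mem_centralizer_iff,
    Subgroup.coe_map, Set.forall_mem_image, SetLike.mem_coe, QuotientGroup.mk'_apply,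
    ← QuotientGroup.mk_mul, QuotientGroup.eq]

theorem factorCentralizer_comap {G G' : Type*} [Group G] [Group G'] (e : G ≃* G')
    (H K : Subgroup G') [K.Normal] :
    (factorCentralizer (H.comap e.toMonoidHom) (K.comap e.toMonoidHom)).map (e : G →* G') =
      factorCentralizer H K := by
  ext x
  obtain ⟨x, rfl⟩ := e.surjective x
  have h1 : e x ∈ (factorCentralizer (H.comap e.toMonoidHom) (K.comap e.toMonoidHom)).map
      (e : G →* G') ↔ x ∈ factorCentralizer (H.comap e.toMonoidHom) (K.comap e.toMonoidHom) := by
    simp [Subgroup.mem_map]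
  rw [h1, mem_factorCentralizer_iff, mem_factorCentralizer_iff, e.surjective.forall]
  simp

theorem IsChiefFactor.comap {G G' : Type*} [Group G] [Group G'] (e : G ≃* G')
    {H K : Subgroup G'} (h : IsChiefFactor H K) :
    IsChiefFactor (H.comap e.toMonoidHom) (K.comap e.toMonoidHom) where
  normal_top := h.normal_top.comap _
  normal_bot := h.normal_bot.comap _
  lt := (Subgroup.comap_lt_comap_of_surjective e.surjective).2 h.lt
  minimal N hN hKN hNH := by
    have hmap : (N.map e.toMonoidHom).comap e.toMonoidHom = N :=
      Subgroup.comap_map_eq_self_of_injective e.injective N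
    have h1 := h.minimal (N.map e.toMonoidHom) (hN.map _ e.surjective)
      ((Subgroup.comap_le_comap_of_surjective e.surjective).1 (by rwa [hmap]))
      (Subgroup.map_le_iff_le_comap.2 hNH)
    rw [← hmap]
    exact h1.imp (fun h => by rw [h]) (fun h => by rw [h])

namespace GroupClass

/-- `LF(f)`: the class of all finite groups `G` such that `G / C_G(H / K) ∈ f(p)` for every chief
factor `H / K` of `G` and every prime `p ∈ π(H / K)`. -/
def localFormation (f : ℕ → GroupClass.{u}) : GroupClass.{u} where
  Mem G _ := Finite G ∧ ∀ (H K : Subgroup G) [H.Normal] [K.Normal], IsChiefFactor H K →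
    ∀ p ∈ primesOf (H ⧸ K.subgroupOf H), (f p).Mem (G ⧸ factorCentralizer H K)
  finite _ _ h := h.1
  iso G G' _ _ e h := by
    obtain ⟨hfin, h⟩ := h
    refine ⟨Finite.of_equiv _ e.toEquiv, fun H K _ _ hHK p hp => ?_⟩
    have hcard : K.relIndex H = (K.comap e.toMonoidHom).relIndex (H.comap e.toMonoidHom) := by
      rw [Subgroup.relIndex_comap, Subgroup.map_comap_eq_self_of_surjective e.surjective]
    have hp' : p ∈ primesOf (H.comap e.toMonoidHom ⧸
        (K.comap e.toMonoidHom).subgroupOf (H.comap e.toMonoidHom)) := by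
      have h2 : p ∈ (K.relIndex H).primeFactors := hp
      rw [hcard] at h2
      exact h2
    exact (f p).iso _ _ (QuotientGroup.congr _ _ e (factorCentralizer_comap e H K))
      (h _ _ (hHK.comap e) p hp')

/-- A covering formation: a local formation `𝔉 = LF(F)`, for a formation function `F` such that
`F(p) = 𝔖_{π(F(p))}` and `p ∈ π(F(p))` for `p ∈ π(𝔉)`, `F(p) = ∅` for the other primes `p`, and
`p ∈ π(F(q))` implies `q ∈ π(F(p))`. Only the values of `F` at primes matter. -/
def IsCoveringFormation (𝔉 : GroupClass.{u}) : Prop :=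
  ∃ F : ℕ → GroupClass.{u},
    (∀ p, p.Prime → (F p).IsFormation) ∧
    𝔉 = localFormation F ∧
    (∀ p ∈ 𝔉.primes, F p = solublePi (F p).primes ∧ p ∈ (F p).primes) ∧
    (∀ p, p.Prime → p ∉ 𝔉.primes → F p = empty) ∧
    (∀ p q, p.Prime → q.Prime → p ∈ (F q).primes → q ∈ (F p).primes)

end GroupClass

/-! Let `p ≠ q` be primes. A finite soluble group `G` has neither of the edges `(p, q)` and `(q, p)`
in its Sylow graph if and only if some Sylow `p`-subgroup centralizes some Sylow `q`-subgroup: an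
elementwise commuting pair lifts from `G / R` to `G` for a normal `r`-subgroup `R`, because the
absence of one of the two edges controls the prime `r ≠ q`, and that of the other the prime `r = q`.

This property passes to quotients. It makes every `q`-element act trivially on the `p`-chief factors
of `G`, hence, by coprime action, on every `p`-subgroup it normalizes; so the edge `(p, q)` does not
occur in subgroups of `G` either. By Hall and Higman's lemma it also lifts from `G / Φ(G)` to `G`.

If `Γ = Γ_s(𝔛)` is undirected, the non-edges come in pairs and all of this applies to the members of
`𝔛_{Γ_s} ∩ 𝔖`, which is therefore the local formation of the function whose value at a vertex `p`
is `𝔖_π`, with `π` the closed neighbourhood of `p` in `Γ`. -/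

open Subgroup
open scoped Pointwise commutatorElement

section Elements

variable {G : Type*} [Group G]

theorem mem_of_pow_eq_one_of_not_dvd_index {N : Subgroup G} [N.Normal] {q k : ℕ} (hq : q.Prime)
    (hN : ¬ q ∣ N.index) {x : G} (hx : x ^ q ^ k = 1) : x ∈ N := by
  have hcop : N.index.Coprime (orderOf x) :=
    ((hq.coprime_iff_not_dvd.2 hN).pow_left k).symm.coprime_dvd_right (orderOf_dvd_of_pow_eq_one hx)
  obtain ⟨m, hm⟩ := exists_pow_eq_self_of_coprime hcop
  exact hm ▸ N.pow_mem (N.pow_index_mem x) m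

theorem eq_one_of_pow_eq_one_of_coprime {x : G} {a b : ℕ} (hab : a.Coprime b) (ha : x ^ a = 1)
    (hb : x ^ b = 1) : x = 1 := by
  simpa only [hab.gcd_eq_one, pow_one] using pow_gcd_eq_one.2 ⟨ha, hb⟩

theorem commutatorElement_pow_left {x y : G} (h : Commute x ⁅x, y⁆) (n : ℕ) :
    ⁅x ^ n, y⁆ = ⁅x, y⁆ ^ n := by
  induction n with
  | zero => simp
  | succ n ih =>
    calc ⁅x ^ (n + 1), y⁆ = x * ⁅x ^ n, y⁆ * x⁻¹ * ⁅x, y⁆ := by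
          simp only [commutatorElement_def, pow_succ']; group
      _ = ⁅x, y⁆ ^ (n + 1) := by
          rw [ih, (h.pow_right n).eq, mul_inv_cancel_right, pow_succ]

theorem commute_of_commute_commutatorElement {x y : G} {a b : ℕ} (hab : a.Coprime b)
    (hx : x ^ a = 1) (hxy : ⁅x, y⁆ ^ b = 1) (h : Commute x ⁅x, y⁆) : Commute x y := by
  have ha : ⁅x, y⁆ ^ a = 1 := by
    rw [← commutatorElement_pow_left h, hx, commutatorElement_one_left]
  exact commutatorElement_eq_one_iff_commute.1 (eq_one_of_pow_eq_one_of_coprime hab ha hxy)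

theorem exists_pow_eq_one_of_mem_of_isPGroup {p : ℕ} {P : Subgroup G} (hP : IsPGroup p P) {x : G}
    (hx : x ∈ P) : ∃ k, x ^ p ^ k = 1 := by
  obtain ⟨k, hk⟩ := hP ⟨x, hx⟩
  exact ⟨k, by simpa [Subtype.ext_iff] using hk⟩

end Elements

section Sylow

variable {G : Type*} [Group G] [Finite G] {p : ℕ} [Fact p.Prime]

theorem map_normalizer_sylow_of_surjective {G' : Type*} [Group G'] {f : G →* G'}
    (hf : Function.Surjective f) (P : Sylow p G) :
    (normalizer ((P : Subgroup G) : Set G)).map f =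
      normalizer (((P : Subgroup G).map f : Subgroup G') : Set G') := by
  refine le_antisymm (le_normalizer_map f) fun g' hg' => ?_
  obtain ⟨g, rfl⟩ := hf g'
  set M := ((P : Subgroup G).map f).comap f
  have hPM : (P : Subgroup G) ≤ M := le_comap_map f _
  have hgPM : ((g • P : Sylow p G) : Subgroup G) ≤ M := by
    rintro _ ⟨x, hx, rfl⟩
    have := (mem_normalizer_iff.1 hg' (f x)).1 (mem_map_of_mem f hx)
    simpa [M] using this
  obtain ⟨t, ht⟩ := MulAction.exists_smul_eq M ((g • P).subtype hgPM) (P.subtype hPM)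
  rw [Sylow.smul_subtype] at ht
  have htg : (t : G) * g ∈ normalizer ((P : Subgroup G) : Set G) :=
    Sylow.smul_eq_iff_mem_normalizer.1 (mul_smul (t : G) g P ▸ Sylow.subtype_injective ht)
  have hft : f t ∈ (normalizer ((P : Subgroup G) : Set G)).map f := map_mono le_normalizer t.2
  simpa using mul_mem (inv_mem hft) (mem_map_of_mem f htg)

theorem map_sylow_eq_top_of_isPGroup {G' : Type*} [Group G'] {f : G →* G'}
    (hf : Function.Surjective f) (hG' : IsPGroup p G') (P : Sylow p G) :
    (P : Subgroup G).map f = ⊤ := by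
  rw [← Sylow.coe_mapSurjective hf P]
  exact ((P.mapSurjective hf).is_maximal' (hG'.to_subgroup ⊤) le_top).symm

theorem dvd_index_frattini (h : p ∣ Nat.card G) : p ∣ (frattini G).index := by
  by_contra hd
  obtain ⟨P⟩ := Sylow.nonempty (p := p) (G := G)
  have hP : (P : Subgroup G) ≤ frattini G := fun x hx =>
    have ⟨_, hk⟩ := exists_pow_eq_one_of_mem_of_isPGroup P.isPGroup' hx
    mem_of_pow_eq_one_of_not_dvd_index Fact.out hd hk
  have hPn : (P : Subgroup G).Normal :=
    normalizer_eq_top_iff.1 (frattini_nongenerating (P.normalizer_sup_eq_top' hP))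
  obtain ⟨M, hM⟩ := exists_right_complement'_of_coprime P.card_coprime_index
  have hMtop : M = ⊤ := by
    refine frattini_nongenerating (eq_top_iff.2 ?_)
    rw [← hM.sup_eq_top, sup_comm]
    exact sup_le_sup_left hP _
  have hdisj := hM.disjoint
  rw [hMtop, disjoint_top] at hdisj
  exact P.ne_bot_of_dvd_card h hdisj

end Sylow

section Solvable

variable {G : Type*} [Group G]

theorem isNilpotent_of_commutator_self_eq_bot {W : Subgroup G} (h : ⁅W, W⁆ = ⊥) :
    Group.IsNilpotent W :=
  isNilpotent_of_lowerCentralSeries_eq_bot (n := 1) h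

theorem exists_normal_commutator_self_eq_bot_le [Group.IsSolvable G] {N : Subgroup G} [N.Normal]
    (hN : N ≠ ⊥) : ∃ A : Subgroup G, A.Normal ∧ A ≤ N ∧ ⁅A, A⁆ = ⊥ ∧ A ≠ ⊥ := by
  classical
  have hex : ∃ n, derivedSeries N n = ⊥ := Group.IsSolvable.solvable
  obtain ⟨n, hn⟩ : ∃ n, Nat.find hex = n + 1 := by
    refine Nat.exists_eq_succ_of_ne_zero fun h0 => hN ?_
    have htop := Nat.find_spec hex
    rwa [h0, derivedSeries_zero, ← subgroupOf_self, subgroupOf_eq_bot, disjoint_self] at htop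
  have hlast : derivedSeries N (n + 1) = ⊥ := hn ▸ Nat.find_spec hex
  refine ⟨(derivedSeries N n).map N.subtype, inferInstance, map_subtype_le _, ?_, ?_⟩
  · rw [← map_commutator, ← derivedSeries_succ, hlast, Subgroup.map_bot]
  · rw [Ne, map_eq_bot_iff_of_injective _ N.subtype_injective]
    exact Nat.find_min hex (by lia)

variable [Finite G]

theorem normal_map_subtype_sylow_of_isNilpotent {W : Subgroup G} [W.Normal] [Group.IsNilpotent W]
    {r : ℕ} [Fact r.Prime] (S : Sylow r W) : ((S : Subgroup W).map W.subtype).Normal := by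
  have := S.characteristic_of_normal inferInstance
  infer_instance

theorem exists_normal_isPGroup_le [Group.IsSolvable G] {N : Subgroup G} [N.Normal] (hN : N ≠ ⊥) :
    ∃ (r : ℕ) (_ : Fact r.Prime) (R : Subgroup G), R.Normal ∧ R ≤ N ∧ IsPGroup r R ∧ R ≠ ⊥ := by
  obtain ⟨A, hA, hAN, hcomm, hne⟩ := exists_normal_commutator_self_eq_bot_le hN
  obtain ⟨r, hr, hrA⟩ := Nat.exists_prime_and_dvd (mt card_eq_one.1 hne)
  have : Fact r.Prime := ⟨hr⟩
  have := isNilpotent_of_commutator_self_eq_bot hcomm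
  obtain ⟨S⟩ := Sylow.nonempty (p := r) (G := A)
  refine ⟨r, ‹_›, _, normal_map_subtype_sylow_of_isNilpotent S, (map_subtype_le _).trans hAN,
    S.isPGroup'.map _, ?_⟩
  rw [Ne, map_eq_bot_iff_of_injective _ A.subtype_injective]
  exact S.ne_bot_of_dvd_card hrA

/-- The condition `O_{p'}(G) = 1` for a finite soluble group `G`: since a nontrivial normal
`p'`-subgroup would contain a nontrivial normal `r`-subgroup of `G` for some prime `r ≠ p`, it is
expressed through the latter. -/
def HasTrivialPrimeToCore (p : ℕ) (G : Type*) [Group G] : Prop :=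
  ∀ r : ℕ, r.Prime → r ≠ p → ∀ R : Subgroup G, R.Normal → IsPGroup r R → R = ⊥

namespace HasTrivialPrimeToCore

variable {p : ℕ}

theorem isPGroup_of_isNilpotent (hG : HasTrivialPrimeToCore p G) (W : Subgroup G) [W.Normal]
    [Group.IsNilpotent W] : IsPGroup p W := by
  refine IsPGroup.of_card
    (Nat.eq_prime_pow_of_unique_prime_dvd Nat.card_pos.ne' fun {r} hr hd => ?_)
  by_contra hrp
  have : Fact r.Prime := ⟨hr⟩
  obtain ⟨S⟩ := Sylow.nonempty (p := r) (G := W)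
  have hS := hG r hr hrp _ (normal_map_subtype_sylow_of_isNilpotent S) (S.isPGroup'.map _)
  rw [map_eq_bot_iff_of_injective _ W.subtype_injective] at hS
  exact S.ne_bot_of_dvd_card hd hS

/-- The core of a Sylow `p`-subgroup is `O_p(G)`, so this is the soluble case of Hall and Higman's
Lemma 1.2.3. -/
theorem centralizer_normalCore_le [Group.IsSolvable G]
    (hG : HasTrivialPrimeToCore p G) (P : Sylow p G) :
    centralizer ((P : Subgroup G).normalCore : Set G) ≤ (P : Subgroup G).normalCore := by
  set K := (P : Subgroup G).normalCore
  set C := centralizer (K : Set G)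
  let D (n : ℕ) : Subgroup G := (derivedSeries C n).map C.subtype
  have hDC (n : ℕ) : D n ≤ C := map_subtype_le _
  have hstep (n : ℕ) (hn : D (n + 1) ≤ K) : D n ≤ K := by
    have hD : ⁅D n, D n⁆ = D (n + 1) := (map_commutator _ _ _).symm
    have hDD : ⁅⁅D n, D n⁆, D n⁆ = ⊥ := by
      rw [hD, eq_bot_iff, ← commutator_eq_bot_iff_le_centralizer.2 (le_refl C), commutator_comm]
      exact commutator_mono (hDC n) hn
    have : Group.IsNilpotent (D n) := isNilpotent_of_lowerCentralSeries_eq_bot (n := 2) hDD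
    exact normal_le_normalCore.2 ((hG.isPGroup_of_isNilpotent (D n)).le_sylow_of_normal P)
  have hdown (n : ℕ) (hn : D n ≤ K) : D 0 ≤ K := by
    induction n with
    | zero => exact hn
    | succ n ih => exact ih (hstep n hn)
  obtain ⟨n, hn⟩ := Group.IsSolvable.solvable (G := C)
  have hC : D 0 = C := by simp only [D, derivedSeries_zero, ← MonoidHom.range_eq_map, range_subtype]
  exact hC ▸ hdown n (by simp only [D, hn, Subgroup.map_bot, bot_le])

end HasTrivialPrimeToCore

theorem exists_normal_isPGroup_map_eq_of_frattini {r : ℕ} [Fact r.Prime]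
    (R : Subgroup (G ⧸ frattini G)) [R.Normal] (hR : IsPGroup r R) :
    ∃ T : Subgroup G, T.Normal ∧ IsPGroup r T ∧ T.map (QuotientGroup.mk' (frattini G)) = R := by
  set f := QuotientGroup.mk' (frattini G)
  have hf : Function.Surjective f := QuotientGroup.mk'_surjective _
  set M := R.comap f
  obtain ⟨S⟩ := Sylow.nonempty (p := r) (G := M)
  set T := (S : Subgroup M).map M.subtype
  have hTR : T.map f = R := by
    have hS := map_sylow_eq_top_of_isPGroup (f.subgroupComap_surjective_of_surjective R hf) hR S
    calc T.map f = ((S : Subgroup M).map (f.subgroupComap R)).map R.subtype := by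
          simp only [T, Subgroup.map_map]; rfl
      _ = R := by rw [hS, ← MonoidHom.range_eq_map, range_subtype]
  have hM : M = T ⊔ frattini G := by
    rw [← QuotientGroup.ker_mk' (frattini G), ← comap_map_eq, hTR]
  have htop : normalizer (T : Set G) ⊔ frattini G = ⊤ := by
    rw [eq_top_iff, ← S.normalizer_sup_eq_top]
    exact sup_le le_sup_left (hM.le.trans (sup_le_sup_right le_normalizer _))
  exact ⟨T, normalizer_eq_top_iff.1 (frattini_nongenerating htop), S.isPGroup'.map _, hTR⟩

theorem HasTrivialPrimeToCore.quotient_frattini {p : ℕ} (hG : HasTrivialPrimeToCore p G) :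
    HasTrivialPrimeToCore p (G ⧸ frattini G) := by
  intro r hr hrp R _ hR
  have : Fact r.Prime := ⟨hr⟩
  obtain ⟨T, hT, hTr, rfl⟩ := exists_normal_isPGroup_map_eq_of_frattini R hR
  rw [hG r hr hrp T hT hTr, Subgroup.map_bot]

end Solvable

section SylowGraph

variable {G : Type*} [Group G]

theorem relIndex_sup_dvd_card {H K : Subgroup G} (h : H ≤ normalizer (K : Set G)) :
    K.relIndex (H ⊔ K) ∣ Nat.card H := by
  have hn : (K.subgroupOf (H ⊔ K)).Normal :=
    normal_subgroupOf_of_le_normalizer (sup_le h le_normalizer)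
  have htop : H.subgroupOf (H ⊔ K) ⊔ K.subgroupOf (H ⊔ K) = ⊤ := by
    rw [← subgroupOf_sup le_sup_left le_sup_right, subgroupOf_self]
  calc K.relIndex (H ⊔ K) = (K.subgroupOf (H ⊔ K)).relIndex (H.subgroupOf (H ⊔ K)) := by
        rw [relIndex, ← relIndex_top_right, ← htop, relIndex_sup_right]
    _ ∣ Nat.card (H.subgroupOf (H ⊔ K)) := index_dvd_card _
    _ = Nat.card H := Nat.card_congr (subgroupOfEquivOfLe le_sup_left).toEquiv

variable [Finite G] {p q : ℕ} [hp : Fact p.Prime] [hq : Fact q.Prime]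

theorem notMem_sylowGraph_self : (p, p) ∉ (sylowGraph G).E := by
  rintro ⟨-, P, hP⟩
  exact P.not_dvd_index ((Nat.dvd_of_mem_primeFactors hP).trans
    ((relIndex_dvd_of_le_left _ le_sup_left).trans (relIndex_dvd_index_of_le le_normalizer)))

/-- Passing from `N_G(P) / P C_G(P)` to `N_G(P) / C_G(P)` only affects the prime `p`. -/
theorem mem_sylowGraph_iff_dvd_relIndex (hpq : p ≠ q) : (p, q) ∈ (sylowGraph G).E ↔
    ∃ P : Sylow p G, q ∣ (centralizer ((P : Subgroup G) : Set G)).relIndex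
      (normalizer ((P : Subgroup G) : Set G)) := by
  have hN (P : Subgroup G) :
      normalizer (P : Set G) ≤ normalizer (centralizer (P : Set G) : Set G) :=
    le_normalizer_of_normal_subgroupOf (centralizer_le_normalizer _)
  constructor
  · rintro ⟨-, P, hP⟩
    exact ⟨P, (Nat.dvd_of_mem_primeFactors hP).trans (relIndex_dvd_of_le_left _ le_sup_right)⟩
  rintro ⟨P, hP⟩
  have hpG : p ∣ Nat.card G := by
    refine (P.isPGroup'.card_eq_or_dvd.resolve_left fun hone => ?_).trans (card_subgroup_dvd_card _)
    rw [card_eq_one.1 hone, coe_bot,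
      centralizer_eq_top_iff_subset.2 (Set.singleton_subset_iff.2 (one_mem _)),
      relIndex_top_left] at hP
    exact hq.out.not_dvd_one hP
  obtain ⟨n, hn⟩ := IsPGroup.iff_card.1 P.isPGroup'
  have hPC : ¬ q ∣ (centralizer ((P : Subgroup G) : Set G)).relIndex (mulCentralizer P) := fun h =>
    hpq ((Nat.prime_dvd_prime_iff_eq hq.out hp.out).1 (hq.out.dvd_of_dvd_pow
      (hn ▸ h.trans (relIndex_sup_dvd_card (le_normalizer.trans (hN P)))))).symm
  rw [← relIndex_mul_relIndex _ (mulCentralizer (P : Subgroup G)) _ le_sup_right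
    (sup_le le_normalizer (centralizer_le_normalizer _)), hq.out.dvd_mul] at hP
  exact ⟨Nat.mem_primeFactors.2 ⟨hp.out, hpG, Nat.card_pos.ne'⟩, P,
    Nat.mem_primeFactors.2 ⟨hq.out, hP.resolve_left hPC, Nat.card_pos.ne'⟩⟩

theorem notMem_sylowGraph_iff (hpq : p ≠ q) : (p, q) ∉ (sylowGraph G).E ↔
    ∀ (P : Sylow p G) (x : G) (k : ℕ), x ^ q ^ k = 1 →
      x ∈ normalizer ((P : Subgroup G) : Set G) → x ∈ centralizer ((P : Subgroup G) : Set G) := by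
  rw [mem_sylowGraph_iff_dvd_relIndex hpq, not_exists]
  refine forall_congr' fun P => ⟨fun h x k hx hxN => ?_, fun h hd => ?_⟩
  · exact mem_of_pow_eq_one_of_not_dvd_index
      (N := (centralizer ((P : Subgroup G) : Set G)).subgroupOf (normalizer (P : Set G)))
      hq.out h (x := ⟨x, hxN⟩) (Subtype.ext hx)
  · obtain ⟨S⟩ := Sylow.nonempty (p := q) (G := normalizer ((P : Subgroup G) : Set G))
    refine S.not_dvd_index (hd.trans (index_dvd_of_le fun x hx => ?_))
    obtain ⟨k, hk⟩ := exists_pow_eq_one_of_mem_of_isPGroup S.isPGroup' hx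
    exact h x k (congrArg Subtype.val hk) x.2

theorem mem_sylowGraph_of_surjective (hpq : p ≠ q) {G' : Type*} [Group G'] [Finite G'] {f : G →* G'}
    (hf : Function.Surjective f) (h : (p, q) ∈ (sylowGraph G').E) : (p, q) ∈ (sylowGraph G).E := by
  rw [mem_sylowGraph_iff_dvd_relIndex hpq] at h ⊢
  obtain ⟨P', hP⟩ := h
  obtain ⟨P, rfl⟩ := Sylow.mapSurjective_surjective hf p P'
  refine ⟨P, hP.trans ?_⟩
  rw [Sylow.coe_mapSurjective, ← map_normalizer_sylow_of_surjective hf, ← relIndex_comap]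
  exact relIndex_dvd_of_le_left _ (map_le_iff_le_comap.1 (map_centralizer_le_centralizer_image _ f))

theorem commutatorElement_mem_of_notMem_sylowGraph_quotient (hpq : p ≠ q) {N : Subgroup G}
    [N.Normal] (h : (p, q) ∉ (sylowGraph (G ⧸ N)).E) (P : Sylow p G) {x y : G} {k : ℕ}
    (hx : x ^ q ^ k = 1) (hxP : x ∈ normalizer ((P : Subgroup G) : Set G)) (hy : y ∈ P) :
    ⁅y, x⁆ ∈ N := by
  set f := QuotientGroup.mk' N
  have hfx : f x ∈ centralizer (((P : Subgroup G).map f : Subgroup (G ⧸ N)) : Set (G ⧸ N)) :=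
    (notMem_sylowGraph_iff hpq).1 h (P.mapSurjective (QuotientGroup.mk'_surjective N)) (f x) k
      (by rw [← map_pow, hx, map_one]) (le_normalizer_map f (mem_map_of_mem f hxP))
  rw [← QuotientGroup.eq_one_iff]
  exact (map_commutatorElement f y x).trans
    (commutatorElement_eq_one_iff_mul_comm.2 (mem_centralizer_iff.1 hfx _ (mem_map_of_mem f hy)))

theorem notMem_sylowGraph_of_iInf_eq_bot (hpq : p ≠ q) {ι : Type*} (N : ι → Subgroup G)
    [∀ i, (N i).Normal] (hN : ⨅ i, N i = ⊥) (h : ∀ i, (p, q) ∉ (sylowGraph (G ⧸ N i)).E) :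
    (p, q) ∉ (sylowGraph G).E := by
  refine (notMem_sylowGraph_iff hpq).2 fun P x k hx hxP => mem_centralizer_iff.2 fun y hy => ?_
  rw [← commutatorElement_eq_one_iff_mul_comm, ← mem_bot, ← hN, mem_iInf]
  exact fun i => commutatorElement_mem_of_notMem_sylowGraph_quotient hpq (h i) P hx hxP hy

theorem notMem_sylowGraph_of_quotient (hpq : p ≠ q) {N : Subgroup G} [N.Normal]
    (hN : (Nat.card N).Coprime p) (h : (p, q) ∉ (sylowGraph (G ⧸ N)).E) :
    (p, q) ∉ (sylowGraph G).E := by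
  refine (notMem_sylowGraph_iff hpq).2 fun P x k hx hxP => mem_centralizer_iff.2 fun y hy => ?_
  obtain ⟨n, hn⟩ := IsPGroup.iff_card.1 P.isPGroup'
  have hdisj : Disjoint N P := disjoint_of_coprime_natCard (hn ▸ hN.pow_right n)
  rw [← commutatorElement_eq_one_iff_mul_comm, ← mem_bot, ← hdisj.eq_bot, mem_inf]
  refine ⟨commutatorElement_mem_of_notMem_sylowGraph_quotient hpq h P hx hxP hy, ?_⟩
  rw [commutatorElement_def, mul_assoc, mul_assoc, ← mul_assoc x]
  exact mul_mem hy ((mem_normalizer_iff.1 hxP _).1 (inv_mem hy))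

end SylowGraph

/-- Some, equivalently every, Sylow `p`-subgroup of `G` centralizes some Sylow `q`-subgroup. -/
def HasCommutingSylows (p q : ℕ) (G : Type*) [Group G] : Prop :=
  ∃ (P : Sylow p G) (Q : Sylow q G), (Q : Subgroup G) ≤ centralizer ((P : Subgroup G) : Set G)

section CommutingSylows

theorem card_quotient_lt_of_ne_bot {G : Type*} [Group G] [Finite G] {N : Subgroup G} (h : N ≠ ⊥) :
    Nat.card (G ⧸ N) < Nat.card G := by
  rw [card_eq_card_quotient_mul_card_subgroup N]
  exact lt_mul_of_one_lt_right Nat.card_pos (N.one_lt_card_iff_ne_bot.2 h)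

theorem HasCommutingSylows.symm {G : Type*} [Group G] {p q : ℕ} (h : HasCommutingSylows p q G) :
    HasCommutingSylows q p G :=
  have ⟨P, Q, hPQ⟩ := h
  ⟨Q, P, le_centralizer_iff.1 hPQ⟩

variable {G : Type*} [Group G] [Finite G] {p q : ℕ} [hp : Fact p.Prime] [hq : Fact q.Prime]

theorem exists_sylow_le_iff_not_dvd_index {H : Subgroup G} :
    (∃ Q : Sylow q G, (Q : Subgroup G) ≤ H) ↔ ¬ q ∣ H.index := by
  refine ⟨fun ⟨Q, hQ⟩ hd => Q.not_dvd_index (hd.trans (index_dvd_of_le hQ)), fun h => ?_⟩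
  obtain ⟨S⟩ := Sylow.nonempty (p := q) (G := H)
  refine ⟨(S.isPGroup'.map H.subtype).toSylow ?_, H.map_subtype_le _⟩
  rw [index_map_subtype]
  exact hq.out.not_dvd_mul S.not_dvd_index h

theorem hasCommutingSylows_iff_not_dvd_index (P : Sylow p G) :
    HasCommutingSylows p q G ↔ ¬ q ∣ (centralizer ((P : Subgroup G) : Set G)).index := by
  rw [← exists_sylow_le_iff_not_dvd_index]
  refine ⟨fun ⟨P', Q, hPQ⟩ => ?_, fun ⟨Q, hPQ⟩ => ⟨P, Q, hPQ⟩⟩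
  obtain ⟨g, rfl⟩ := MulAction.exists_smul_eq G P' P
  refine ⟨g • Q, ?_⟩
  rintro _ ⟨y, hy, rfl⟩
  refine mem_centralizer_iff.2 ?_
  rintro _ ⟨x, hx, rfl⟩
  change MulAut.conj g x * MulAut.conj g y = MulAut.conj g y * MulAut.conj g x
  rw [← map_mul, ← map_mul, mem_centralizer_iff.1 (hPQ hy) x hx]

theorem hasCommutingSylows_of_not_dvd_card (h : ¬ q ∣ Nat.card G) : HasCommutingSylows p q G := by
  obtain ⟨P⟩ := Sylow.nonempty (p := p) (G := G)
  exact (hasCommutingSylows_iff_not_dvd_index P).2 fun hd => h (hd.trans (index_dvd_card _))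

theorem index_dvd_index_map_mk_mul_card (H N : Subgroup G) [N.Normal] :
    H.index ∣ (H.map (QuotientGroup.mk' N)).index * Nat.card N := by
  obtain ⟨m, hm⟩ := card_map_dvd H (QuotientGroup.mk' N)
  refine ⟨m, Nat.eq_of_mul_eq_mul_left (Nat.card_pos (α := H.map (QuotientGroup.mk' N))) ?_⟩
  calc Nat.card (H.map (QuotientGroup.mk' N)) * ((H.map (QuotientGroup.mk' N)).index * Nat.card N)
      = Nat.card G := by rw [← mul_assoc, card_mul_index, ← card_eq_card_quotient_mul_card_subgroup]
    _ = _ := by rw [← H.card_mul_index, hm]; ring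

theorem coprime_card_of_isPGroup (hpq : p ≠ q) {N : Subgroup G} (hN : IsPGroup p N) :
    (Nat.card N).Coprime q := by
  obtain ⟨n, hn⟩ := IsPGroup.iff_card.1 hN
  exact hn ▸ ((Nat.coprime_primes hp.out hq.out).2 hpq).pow_left n

namespace HasCommutingSylows

theorem of_surjective {G' : Type*} [Group G'] {f : G →* G'} (hf : Function.Surjective f)
    (h : HasCommutingSylows p q G) : HasCommutingSylows p q G' := by
  obtain ⟨P, Q, hPQ⟩ := h
  refine ⟨P.mapSurjective hf, Q.mapSurjective hf, ?_⟩
  rw [Sylow.coe_mapSurjective, Sylow.coe_mapSurjective]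
  exact (map_mono hPQ).trans (map_centralizer_le_centralizer_image _ f)

theorem notMem_sylowGraph (hpq : p ≠ q) (h : HasCommutingSylows p q G) :
    (p, q) ∉ (sylowGraph G).E := by
  rw [mem_sylowGraph_iff_dvd_relIndex hpq, not_exists]
  exact fun P hd => (hasCommutingSylows_iff_not_dvd_index P).1 h
    (hd.trans (relIndex_dvd_index_of_le (centralizer_le_normalizer _)))

theorem not_dvd_index_centralizer (h : HasCommutingSylows p q G) {N : Subgroup G} [N.Normal]
    (hN : IsPGroup p N) : ¬ q ∣ (centralizer (N : Set G)).index := by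
  obtain ⟨P⟩ := Sylow.nonempty (p := p) (G := G)
  exact fun hd => (hasCommutingSylows_iff_not_dvd_index P).1 h
    (hd.trans (index_dvd_of_le (centralizer_le (hN.le_sylow_of_normal P))))

theorem of_quotient (hpq : p ≠ q) (hE : (p, q) ∉ (sylowGraph G).E) {N : Subgroup G} [N.Normal]
    (hN : (Nat.card N).Coprime q) (h : HasCommutingSylows p q (G ⧸ N)) :
    HasCommutingSylows p q G := by
  obtain ⟨P⟩ := Sylow.nonempty (p := p) (G := G)
  set L := normalizer ((P : Subgroup G) : Set G)
  set f := QuotientGroup.mk' N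
  have hf : Function.Surjective f := QuotientGroup.mk'_surjective N
  have hL' : ¬ q ∣ (L.map f).index := fun hd => by
    rw [map_normalizer_sylow_of_surjective hf P] at hd
    exact (hasCommutingSylows_iff_not_dvd_index (P.mapSurjective hf)).1 h
      (hd.trans (index_dvd_of_le (centralizer_le_normalizer _)))
  have hL : ¬ q ∣ L.index := fun hd => hq.out.not_dvd_mul hL'
    (hq.out.coprime_iff_not_dvd.1 hN.symm) (hd.trans (index_dvd_index_map_mk_mul_card L N))
  rw [mem_sylowGraph_iff_dvd_relIndex hpq, not_exists] at hE
  rw [hasCommutingSylows_iff_not_dvd_index P,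
    ← relIndex_mul_index (centralizer_le_normalizer ((P : Subgroup G) : Set G))]
  exact hq.out.not_dvd_mul (hE P) hL

end HasCommutingSylows

theorem hasCommutingSylows_of_notMem_sylowGraph (hpq : p ≠ q) {G : Type*} [Group G] [Finite G]
    [Group.IsSolvable G] (h₁ : (p, q) ∉ (sylowGraph G).E) (h₂ : (q, p) ∉ (sylowGraph G).E) :
    HasCommutingSylows p q G := by
  induction hn : Nat.card G using Nat.strong_induction_on generalizing G with
  | _ n ih =>
  by_cases htop : (⊤ : Subgroup G) = ⊥
  · refine hasCommutingSylows_of_not_dvd_card fun hd => hq.out.not_dvd_one ?_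
    rwa [← card_top, htop, card_bot] at hd
  obtain ⟨r, hr, R, hRn, -, hR, hne⟩ := exists_normal_isPGroup_le htop
  have hsurj := QuotientGroup.mk'_surjective R
  have hquot : HasCommutingSylows p q (G ⧸ R) :=
    ih _ (hn ▸ card_quotient_lt_of_ne_bot hne) (mt (mem_sylowGraph_of_surjective hpq hsurj) h₁)
      (mt (mem_sylowGraph_of_surjective hpq.symm hsurj) h₂) rfl
  rcases eq_or_ne r q with rfl | hrq
  · exact (hquot.symm.of_quotient hpq.symm h₂ (coprime_card_of_isPGroup hpq.symm hR)).symm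
  · exact hquot.of_quotient hpq h₁ (coprime_card_of_isPGroup hrq hR)

/-- `Q` centralizes `O_p(G)`, which is self-centralizing. -/
theorem HasTrivialPrimeToCore.not_dvd_card [Group.IsSolvable G] (hpq : p ≠ q)
    (hG : HasTrivialPrimeToCore p G) (h : HasCommutingSylows p q G) : ¬ q ∣ Nat.card G := by
  obtain ⟨P, Q, hPQ⟩ := h
  have hQP : (Q : Subgroup G) ≤ P := (hPQ.trans (centralizer_le (normalCore_le _))).trans
    ((hG.centralizer_normalCore_le P).trans (normalCore_le _))
  have hdisj := IsPGroup.disjoint_of_ne q p hpq.symm (Q : Subgroup G) P Q.isPGroup' P.isPGroup'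
  exact fun hd => Q.ne_bot_of_dvd_card hd (hdisj.eq_bot_of_le hQP)

theorem hasCommutingSylows_of_quotient_frattini_of_hasTrivialPrimeToCore [Group.IsSolvable G]
    (hpq : p ≠ q) (hG : HasTrivialPrimeToCore p G) (h : HasCommutingSylows p q (G ⧸ frattini G)) :
    HasCommutingSylows p q G :=
  hasCommutingSylows_of_not_dvd_card fun hd =>
    hG.quotient_frattini.not_dvd_card hpq h (dvd_index_frattini hd)

theorem HasCommutingSylows.of_quotient_frattini (hpq : p ≠ q) {G : Type*} [Group G] [Finite G]
    [Group.IsSolvable G] (h : HasCommutingSylows p q (G ⧸ frattini G)) :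
    HasCommutingSylows p q G := by
  induction hn : Nat.card G using Nat.strong_induction_on generalizing G with
  | _ n ih =>
  by_cases hGp : HasTrivialPrimeToCore p G
  · exact hasCommutingSylows_of_quotient_frattini_of_hasTrivialPrimeToCore hpq hGp h
  by_cases hGq : HasTrivialPrimeToCore q G
  · exact (hasCommutingSylows_of_quotient_frattini_of_hasTrivialPrimeToCore hpq.symm hGq
      h.symm).symm
  have hquot (T : Subgroup G) [T.Normal] (hT : T ≠ ⊥) : HasCommutingSylows p q (G ⧸ T) := by
    have hsurj := QuotientGroup.mk'_surjective T
    exact ih _ (hn ▸ card_quotient_lt_of_ne_bot hT) (h.of_surjective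
      (QuotientGroup.map_surjective_of_surjective (frattini G) (frattini (G ⧸ T)) _
        ((QuotientGroup.mk'_surjective _).comp hsurj)
        (frattini_le_comap_frattini_of_surjective hsurj))) rfl
  simp only [HasTrivialPrimeToCore, not_forall] at hGp hGq
  obtain ⟨r, hr, hrp, T, hTn, hT, hTne⟩ := hGp
  obtain ⟨s, hs, hsq, S, hSn, hS, hSne⟩ := hGq
  have : Fact r.Prime := ⟨hr⟩
  have : Fact s.Prime := ⟨hs⟩
  exact hasCommutingSylows_of_notMem_sylowGraph hpq
    (notMem_sylowGraph_of_quotient hpq (coprime_card_of_isPGroup hrp hT)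
      ((hquot T hTne).notMem_sylowGraph hpq))
    (notMem_sylowGraph_of_quotient hpq.symm (coprime_card_of_isPGroup hsq hS)
      ((hquot S hSne).symm.notMem_sylowGraph hpq.symm))

end CommutingSylows

section ChiefFactor

variable {G : Type*} [Group G]

theorem commutatorElement_mem_of_mem_factorCentralizer {H K : Subgroup G} [K.Normal] {x y : G}
    (hx : x ∈ factorCentralizer H K) (hy : y ∈ H) : ⁅x, y⁆ ∈ K := by
  simpa only [commutatorElement_def, mul_inv_rev, inv_inv, mul_assoc] using
    (mem_factorCentralizer_iff H K x⁻¹).1 (inv_mem hx) y⁻¹ (inv_mem hy)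

theorem index_factorCentralizer (H K : Subgroup G) [K.Normal] : (factorCentralizer H K).index =
    (centralizer ((H.map (QuotientGroup.mk' K) : Subgroup (G ⧸ K)) : Set (G ⧸ K))).index :=
  index_comap_of_surjective _ (QuotientGroup.mk'_surjective K)

theorem card_map_mk (H K : Subgroup G) [K.Normal] :
    Nat.card (H.map (QuotientGroup.mk' K)) = K.relIndex H := by
  rw [← relIndex_ker, QuotientGroup.ker_mk']

theorem IsChiefFactor.eq_map_mk_of_le {H K : Subgroup G} [K.Normal] (h : IsChiefFactor H K)
    {T : Subgroup (G ⧸ K)} (hT : T.Normal) (hTH : T ≤ H.map (QuotientGroup.mk' K)) (hne : T ≠ ⊥) :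
    T = H.map (QuotientGroup.mk' K) := by
  have hmap : (T.comap (QuotientGroup.mk' K)).map (QuotientGroup.mk' K) = T :=
    map_comap_eq_self_of_surjective (QuotientGroup.mk'_surjective K) T
  have hKT : K ≤ T.comap (QuotientGroup.mk' K) := QuotientGroup.le_comap_mk' K T
  have hTH' : T.comap (QuotientGroup.mk' K) ≤ H := by
    refine (comap_mono hTH).trans ?_
    rw [QuotientGroup.comap_map_mk']
    exact sup_le h.lt.le le_rfl
  rcases h.minimal _ (hT.comap _) hKT hTH' with hK | hH
  · rw [hK, QuotientGroup.map_mk'_self] at hmap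
    exact absurd hmap.symm hne
  · rw [← hH, hmap]

variable [Finite G]

theorem chiefFactor_induction {C : Subgroup G → Prop} (bot : C ⊥)
    (step : ∀ (H K : Subgroup G) [H.Normal] [K.Normal], IsChiefFactor H K → C K → C H)
    (H : Subgroup G) [hH : H.Normal] : C H := by
  induction H using WellFoundedLT.induction generalizing hH with
  | _ H ih =>
  rcases eq_or_ne H ⊥ with rfl | hne
  · exact bot
  obtain ⟨K, hK⟩ := (Set.toFinite {K : Subgroup G | K.Normal ∧ K < H}).exists_maximal
    ⟨⊥, inferInstance, bot_lt_iff_ne_bot.2 hne⟩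
  obtain ⟨hKn, hKH⟩ := hK.prop
  refine step H K ⟨inferInstance, hKn, hKH, fun N hN hKN hNH => ?_⟩ (ih K hKH)
  exact (eq_or_lt_of_le hNH).symm.imp_left fun hlt => (hK.eq_of_ge ⟨hN, hlt⟩ hKN)

theorem exists_isChiefFactor_dvd_relIndex {p : ℕ} (hp : p.Prime) (h : p ∣ Nat.card G) :
    ∃ H K : Subgroup G, IsChiefFactor H K ∧ p ∣ K.relIndex H := by
  by_contra! hcon
  have hnot : ¬ p ∣ Nat.card (⊤ : Subgroup G) := by
    refine chiefFactor_induction (C := fun H => ¬ p ∣ Nat.card H) ?_ (fun H K _ _ hHK hK => ?_) ⊤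
    · rw [card_bot]
      exact hp.not_dvd_one
    · rw [← relIndex_bot_left, ← relIndex_mul_relIndex _ _ _ bot_le hHK.lt.le, relIndex_bot_left]
      exact hp.not_dvd_mul hK (hcon H K hHK)
  exact hnot (card_top (G := G) ▸ h)

theorem IsChiefFactor.isPGroup_map_mk [Group.IsSolvable G] {H K : Subgroup G} [H.Normal] [K.Normal]
    (h : IsChiefFactor H K) {p : ℕ} (hp : p.Prime) (hd : p ∣ K.relIndex H) :
    IsPGroup p (H.map (QuotientGroup.mk' K)) := by
  have hHn : (H.map (QuotientGroup.mk' K)).Normal :=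
    Normal.map ‹_› _ (QuotientGroup.mk'_surjective K)
  have hne : H.map (QuotientGroup.mk' K) ≠ ⊥ := fun hbot => by
    rw [← card_map_mk, hbot, card_bot] at hd
    exact hp.not_dvd_one hd
  obtain ⟨r, hr, R, hRn, hRH, hR, hRne⟩ := exists_normal_isPGroup_le hne
  obtain rfl := h.eq_map_mk_of_le hRn hRH hRne
  obtain ⟨n, hn⟩ := IsPGroup.iff_card.1 hR
  rw [← card_map_mk, hn] at hd
  rwa [(Nat.prime_dvd_prime_iff_eq hp hr.out).1 (hp.dvd_of_dvd_pow hd)]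

end ChiefFactor

section Solvable

variable {G : Type*} [Group G]

theorem isSolvable_of_quotient_centralizer (N : Subgroup G) [N.Normal]
    [Group.IsSolvable (G ⧸ centralizer (N : Set G))] : Group.IsSolvable N := by
  let f := (QuotientGroup.mk' (centralizer (N : Set G))).comp N.subtype
  have hf (x : f.ker) : (x : G) ∈ centralizer (N : Set G) := (QuotientGroup.eq_one_iff _).1 x.2
  have : Group.IsSolvable f.ker := Group.isSolvable_of_comm fun x y =>
    Subtype.ext (Subtype.ext (mem_centralizer_iff.1 (hf y) x x.1.2))
  exact Group.isSolvable_of_ker_le_range f.ker.subtype f (range_subtype _).ge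

theorem isSolvable_of_quotient_factorCentralizer {H K : Subgroup G} [H.Normal] [K.Normal]
    (hKH : K ≤ H) [Group.IsSolvable K] [Group.IsSolvable (G ⧸ factorCentralizer H K)] :
    Group.IsSolvable H := by
  set M := H.map (QuotientGroup.mk' K)
  have hM : M.Normal := Normal.map ‹_› _ (QuotientGroup.mk'_surjective K)
  have : Group.IsSolvable ((G ⧸ K) ⧸ centralizer (M : Set (G ⧸ K))) :=
    Group.isSolvable_of_surjective (f := QuotientGroup.map (factorCentralizer H K) _
      (QuotientGroup.mk' K) le_rfl) (QuotientGroup.map_surjective_of_surjective _ _ _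
        ((QuotientGroup.mk'_surjective _).comp (QuotientGroup.mk'_surjective K)) _)
  have := isSolvable_of_quotient_centralizer M
  refine Group.isSolvable_of_ker_le_range (inclusion hKH) ((QuotientGroup.mk' K).subgroupMap H) ?_
  exact fun x hx => ⟨⟨x, (QuotientGroup.eq_one_iff (x : G)).1 (congrArg Subtype.val hx)⟩, rfl⟩

theorem isSolvable_of_chiefFactor [Finite G]
    (h : ∀ (H K : Subgroup G) [H.Normal] [K.Normal], IsChiefFactor H K →
      Group.IsSolvable (G ⧸ factorCentralizer H K)) : Group.IsSolvable G := by
  have : Group.IsSolvable (⊤ : Subgroup G) := by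
    refine chiefFactor_induction (C := fun H => Group.IsSolvable H) inferInstance ?_ ⊤
    intro H K _ _ hHK hK
    have := h H K hHK
    exact isSolvable_of_quotient_factorCentralizer hHK.lt.le
  exact Group.isSolvable_of_surjective (f := (⊤ : Subgroup G).subtype) topEquiv.surjective

theorem isSolvable_of_iInf_eq_bot {ι : Type*} [Finite ι] (N : ι → Subgroup G) [∀ i, (N i).Normal]
    (hN : ⨅ i, N i = ⊥) (h : ∀ i, Group.IsSolvable (G ⧸ N i)) : Group.IsSolvable G := by
  choose n hn using fun i => (h i).solvable
  obtain ⟨m, hm⟩ := (Set.finite_range n).bddAbove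
  refine ⟨⟨m, eq_bot_iff.2 (hN ▸ le_iInf fun i => ?_)⟩⟩
  have hmap := map_derivedSeries_le_derivedSeries (QuotientGroup.mk' (N i)) (n i)
  rw [hn i, le_bot_iff, Subgroup.map_eq_bot_iff, QuotientGroup.ker_mk'] at hmap
  exact (derivedSeries_antitone G (hm ⟨i, rfl⟩)).trans hmap

end Solvable

/-- The `q`-elements of `G` centralize every chief factor of `G` of order divisible by `p`. -/
def CentralizesChiefFactors (p q : ℕ) (G : Type*) [Group G] : Prop :=
  ∀ (H K : Subgroup G) [H.Normal] [K.Normal], IsChiefFactor H K → p ∣ K.relIndex H →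
    ¬ q ∣ (factorCentralizer H K).index

section CentralizesChiefFactors

variable {G : Type*} [Group G] [Finite G] {p q : ℕ} [hp : Fact p.Prime] [hq : Fact q.Prime]

theorem HasCommutingSylows.centralizesChiefFactors [Group.IsSolvable G]
    (h : HasCommutingSylows p q G) : CentralizesChiefFactors p q G := by
  intro H K _ _ hHK hd
  have hHn : (H.map (QuotientGroup.mk' K)).Normal :=
    Normal.map ‹_› _ (QuotientGroup.mk'_surjective K)
  rw [index_factorCentralizer]
  exact (h.of_surjective (QuotientGroup.mk'_surjective K)).not_dvd_index_centralizer
    (hHK.isPGroup_map_mk hp.out hd)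

namespace CentralizesChiefFactors

/-- By induction along a chief series: if `y ∈ P` lies in the upper term of a `p`-chief factor, then
`x` centralizes `⁅x, y⁆`, and `x` and `⁅x, y⁆` have coprime orders. -/
theorem commute (hpq : p ≠ q) (h : CentralizesChiefFactors p q G) {P : Subgroup G}
    (hP : IsPGroup p P) {x : G} {k : ℕ} (hx : x ^ q ^ k = 1) (hxP : x ∈ normalizer (P : Set G))
    {y : G} (hy : y ∈ P) : Commute x y := by
  suffices hC : ∀ y ∈ P, y ∈ (⊤ : Subgroup G) → Commute x y from hC y hy (mem_top y)
  refine chiefFactor_induction (C := fun H => ∀ y ∈ P, y ∈ H → Commute x y) ?_ ?_ ⊤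
  · rintro y - hy
    exact mem_bot.1 hy ▸ Commute.one_right x
  intro H K _ _ hHK ih y hyP hyH
  by_cases hd : p ∣ K.relIndex H
  · have hxC : x ∈ factorCentralizer H K :=
      mem_of_pow_eq_one_of_not_dvd_index hq.out (h H K hHK hd) hx
    have hP' : ⁅x, y⁆ ∈ P :=
      mul_mem ((mem_normalizer_iff.1 hxP y).1 hyP) (inv_mem hyP)
    have hK : ⁅x, y⁆ ∈ K := commutatorElement_mem_of_mem_factorCentralizer hxC hyH
    obtain ⟨m, hm⟩ := exists_pow_eq_one_of_mem_of_isPGroup hP hP'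
    exact commute_of_commute_commutatorElement
      (Nat.Coprime.pow _ _ ((Nat.coprime_primes hq.out hp.out).2 hpq.symm)) hx hm (ih _ hP' hK)
  · obtain ⟨m, hm⟩ := exists_pow_eq_one_of_mem_of_isPGroup hP hyP
    exact ih y hyP (mem_of_pow_eq_one_of_not_dvd_index (N := K.subgroupOf H) (x := ⟨y, hyH⟩)
      hp.out hd (Subtype.ext hm))

theorem notMem_sylowGraph_of_injective (hpq : p ≠ q) (h : CentralizesChiefFactors p q G)
    {L : Type*} [Group L] [Finite L] {f : L →* G} (hf : Function.Injective f) :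
    (p, q) ∉ (sylowGraph L).E := by
  refine (notMem_sylowGraph_iff hpq).2 fun P x k hx hxP => mem_centralizer_iff.2 fun y hy => hf ?_
  rw [map_mul, map_mul]
  exact (h.commute hpq (P.isPGroup'.map f) (by rw [← map_pow, hx, map_one])
    (le_normalizer_map f (mem_map_of_mem f hxP)) (mem_map_of_mem f hy)).eq.symm

end CentralizesChiefFactors

end CentralizesChiefFactors

theorem mem_primesOf_iff {α : Type*} [Finite α] [Nonempty α] {p : ℕ} :
    p ∈ primesOf α ↔ p.Prime ∧ p ∣ Nat.card α :=
  Nat.mem_primeFactors_of_ne_zero Nat.card_pos.ne'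

theorem exists_mem_primesOf_quotient {G : Type*} [Group G] [Finite G] {ι : Type*}
    (N : ι → Subgroup G) [∀ i, (N i).Normal] (hN : ⨅ i, N i = ⊥) {p : ℕ} (hp : p ∈ primesOf G) :
    ∃ i, p ∈ primesOf (G ⧸ N i) := by
  obtain ⟨hp, hd⟩ := mem_primesOf_iff.1 hp
  have : Fact p.Prime := ⟨hp⟩
  by_contra! hcon
  obtain ⟨P⟩ := Sylow.nonempty (p := p) (G := G)
  refine P.ne_bot_of_dvd_card hd (eq_bot_iff.2 (hN ▸ le_iInf fun i x hx => ?_))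
  obtain ⟨k, hk⟩ := exists_pow_eq_one_of_mem_of_isPGroup P.isPGroup' hx
  exact mem_of_pow_eq_one_of_not_dvd_index hp (fun hd => hcon i (mem_primesOf_iff.2 ⟨hp, hd⟩)) hk

namespace PrimeGraph

/-- The vertex `p` together with the endpoints of the edges that start at `p`. -/
def closedNeighbors (Γ : PrimeGraph) (p : ℕ) : Set ℕ := {q | q = p ∨ (p, q) ∈ Γ.E}

variable {Γ : PrimeGraph} {p q : ℕ}

theorem closedNeighbors_subset (hp : p ∈ Γ.V) : Γ.closedNeighbors p ⊆ Γ.V := by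
  rintro q (rfl | hq)
  · exact hp
  · exact Γ.right_mem _ hq

theorem IsUndirected.mem_closedNeighbors_comm (hΓ : Γ.IsUndirected) :
    q ∈ Γ.closedNeighbors p ↔ p ∈ Γ.closedNeighbors q :=
  or_congr eq_comm (hΓ p q)

end PrimeGraph

namespace GroupClass

theorem ext_mem {𝔛 𝔜 : GroupClass.{u}} (h : ∀ (G : Type u) [Group G], 𝔛.Mem G ↔ 𝔜.Mem G) :
    𝔛 = 𝔜 := by
  cases 𝔛
  cases 𝔜
  congr
  funext G _
  exact propext (h G)

theorem IsFormation.inter {𝔛 𝔜 : GroupClass.{u}} (h𝔛 : 𝔛.IsFormation) (h𝔜 : 𝔜.IsFormation) :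
    (𝔛.inter 𝔜).IsFormation :=
  ⟨fun G H _ _ f hf h => ⟨h𝔛.1 G H f hf h.1, h𝔜.1 G H f hf h.2⟩,
    fun G _ _ n N _ h hN => ⟨h𝔛.2 G n N (fun i => (h i).1) hN, h𝔜.2 G n N (fun i => (h i).2) hN⟩⟩

theorem isFormation_empty : empty.{u}.IsFormation :=
  ⟨fun _ _ _ _ _ _ h => h, fun _ _ _ _ _ _ h _ => h 0⟩

theorem isFormation_soluble : soluble.{u}.IsFormation :=
  ⟨fun _ _ _ _ f hf ⟨_, _⟩ => ⟨Finite.of_surjective f hf, Group.isSolvable_of_surjective hf⟩,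
    fun _ _ _ _ N _ h hN => ⟨‹_›, isSolvable_of_iInf_eq_bot N hN fun i => (h i).2⟩⟩

theorem isFormation_solublePi (π : Set ℕ) : (solublePi.{u} π).IsFormation := by
  refine ⟨fun G H _ _ f hf h => ⟨isFormation_soluble.1 G H f hf h.1, ?_⟩,
    fun G _ _ n N _ h hN => ⟨isFormation_soluble.2 G n N (fun i => (h i).1) hN, fun p hp => ?_⟩⟩
  · have := h.1.1
    exact (primesOf_subset_of_dvd (card_dvd_of_surjective f hf)).trans h.2
  · obtain ⟨i, hi⟩ := exists_mem_primesOf_quotient N hN hp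
    exact (h i).2 hi

section SylowClosure

variable {𝔛 : GroupClass.{u}} {G : Type u} [Group G]

theorem prime_of_mem_sylowGraph {p : ℕ} (h : p ∈ 𝔛.sylowGraph.V) : p.Prime :=
  have ⟨_, _, _, _, hp⟩ := h
  Nat.prime_of_mem_primeFactors hp

theorem mem_sylowClosure_iff [Finite G] : 𝔛.sylowClosure.Mem G ↔
    primesOf G ⊆ 𝔛.sylowGraph.V ∧ ∀ (p q : ℕ) [Fact p.Prime] [Fact q.Prime], p ≠ q →
      (p, q) ∉ 𝔛.sylowGraph.E → (p, q) ∉ (_root_.sylowGraph G).E := by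
  refine ⟨fun ⟨_, hV, hE⟩ => ⟨hV, fun p q _ _ _ hpq => mt (@hE (p, q)) hpq⟩,
    fun ⟨hV, hE⟩ => ⟨‹_›, hV, ?_⟩⟩
  rintro ⟨p, q⟩ h
  have : Fact p.Prime := ⟨Nat.prime_of_mem_primeFactors ((_root_.sylowGraph G).left_mem _ h)⟩
  have : Fact q.Prime := ⟨Nat.prime_of_mem_primeFactors ((_root_.sylowGraph G).right_mem _ h)⟩
  rcases eq_or_ne p q with rfl | hpq
  · exact absurd h notMem_sylowGraph_self
  · exact not_not.1 fun hE' => hE p q hpq hE' h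

theorem isFormation_sylowClosure : 𝔛.sylowClosure.IsFormation := by
  refine ⟨fun G H _ _ f hf hG => ?_, fun G _ _ n N _ h hN => ?_⟩
  · have := 𝔛.sylowClosure.finite G hG
    have := Finite.of_surjective f hf
    obtain ⟨hV, hE⟩ := mem_sylowClosure_iff.1 hG
    exact mem_sylowClosure_iff.2
      ⟨(primesOf_subset_of_dvd (card_dvd_of_surjective f hf)).trans hV,
        fun p q _ _ hpq hpq' => mt (mem_sylowGraph_of_surjective hpq hf) (hE p q hpq hpq')⟩
  · refine mem_sylowClosure_iff.2 ⟨fun p hp => ?_, fun p q _ _ hpq hpq' =>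
      notMem_sylowGraph_of_iInf_eq_bot hpq N hN fun i =>
        (mem_sylowClosure_iff.1 (h i)).2 p q hpq hpq'⟩
    obtain ⟨i, hi⟩ := exists_mem_primesOf_quotient N hN hp
    exact (mem_sylowClosure_iff.1 (h i)).1 hi

variable [Finite G] [Group.IsSolvable G] {p q : ℕ} [Fact p.Prime] [Fact q.Prime]

theorem hasCommutingSylows_of_mem_sylowClosure (h𝔛 : 𝔛.sylowGraph.IsUndirected)
    (hG : 𝔛.sylowClosure.Mem G) (hpq : p ≠ q) (hE : (p, q) ∉ 𝔛.sylowGraph.E) :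
    HasCommutingSylows p q G :=
  have hG' := (mem_sylowClosure_iff.1 hG).2
  hasCommutingSylows_of_notMem_sylowGraph hpq (hG' p q hpq hE)
    (hG' q p hpq.symm (mt (h𝔛 p q).2 hE))

theorem centralizesChiefFactors_of_mem_sylowClosure (h𝔛 : 𝔛.sylowGraph.IsUndirected)
    (hG : 𝔛.sylowClosure.Mem G) (hpq : p ≠ q) (hE : (p, q) ∉ 𝔛.sylowGraph.E) :
    CentralizesChiefFactors p q G :=
  (hasCommutingSylows_of_mem_sylowClosure h𝔛 hG hpq hE).centralizesChiefFactors

end SylowClosure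

theorem isHereditary_sylowClosure_inter_soluble {𝔛 : GroupClass.{u}}
    (h𝔛 : 𝔛.sylowGraph.IsUndirected) : (𝔛.sylowClosure.inter soluble).IsHereditary := by
  rintro G _ H ⟨hG, _, _⟩
  refine ⟨mem_sylowClosure_iff.2 ⟨?_, fun p q _ _ hpq hE => ?_⟩, inferInstance, inferInstance⟩
  · exact (primesOf_subset_of_dvd (card_subgroup_dvd_card H)).trans (mem_sylowClosure_iff.1 hG).1
  · exact (centralizesChiefFactors_of_mem_sylowClosure h𝔛 hG hpq hE).notMem_sylowGraph_of_injective
      hpq H.subtype_injective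

theorem isSaturated_sylowClosure_inter_soluble {𝔛 : GroupClass.{u}}
    (h𝔛 : 𝔛.sylowGraph.IsUndirected) : (𝔛.sylowClosure.inter soluble).IsSaturated := by
  rintro G _ _ ⟨hG, _, _⟩
  have : Group.IsNilpotent (frattini G) := frattini_nilpotent
  have : Group.IsSolvable G :=
    (Group.isSolvable_iff_subgroup_quotient (frattini G)).2 ⟨inferInstance, inferInstance⟩
  refine ⟨mem_sylowClosure_iff.2 ⟨fun p hp => ?_, fun p q _ _ hpq hE => ?_⟩, ‹_›, ‹_›⟩
  · obtain ⟨hp, hd⟩ := mem_primesOf_iff.1 hp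
    have : Fact p.Prime := ⟨hp⟩
    exact (mem_sylowClosure_iff.1 hG).1 (mem_primesOf_iff.2 ⟨hp, dvd_index_frattini hd⟩)
  · exact (HasCommutingSylows.of_quotient_frattini hpq
      (hasCommutingSylows_of_mem_sylowClosure h𝔛 hG hpq hE)).notMem_sylowGraph hpq

section NeighbourFormation

open Classical in
/-- The formation function of the covering formation attached to a graph `Γ`: its value at a vertex
`p` is `𝔖_π` for `π` the closed neighbourhood of `p`, and it is empty outside `Γ`. -/
noncomputable def neighbourFormation (Γ : PrimeGraph) (p : ℕ) : GroupClass.{u} :=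
  if p ∈ Γ.V then solublePi (Γ.closedNeighbors p) else empty

variable {Γ : PrimeGraph} {p q : ℕ}

theorem neighbourFormation_of_mem (h : p ∈ Γ.V) :
    neighbourFormation.{u} Γ p = solublePi (Γ.closedNeighbors p) := if_pos h

theorem neighbourFormation_of_notMem (h : p ∉ Γ.V) : neighbourFormation.{u} Γ p = empty := if_neg h

theorem mem_neighbourFormation_iff {G : Type u} [Group G] : (neighbourFormation Γ p).Mem G ↔
    p ∈ Γ.V ∧ soluble.Mem G ∧ primesOf G ⊆ Γ.closedNeighbors p := by
  by_cases hp : p ∈ Γ.V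
  · rw [neighbourFormation_of_mem hp]
    exact (and_iff_right hp).symm
  · rw [neighbourFormation_of_notMem hp]
    exact ⟨False.elim, fun h => hp h.1⟩

theorem isFormation_neighbourFormation : (neighbourFormation.{u} Γ p).IsFormation := by
  by_cases hp : p ∈ Γ.V
  · exact neighbourFormation_of_mem.{u} hp ▸ isFormation_solublePi _
  · exact neighbourFormation_of_notMem.{u} hp ▸ isFormation_empty

theorem exists_primesOf_eq_singleton (hp : p.Prime) :
    ∃ (G : Type u) (_ : Group G), soluble.Mem G ∧ primesOf G = {p} := by
  have : NeZero p := ⟨hp.ne_zero⟩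
  refine ⟨ULift.{u} (Multiplicative (ZMod p)), inferInstance, ⟨inferInstance, inferInstance⟩, ?_⟩
  ext q
  simp [primesOf, hp.primeFactors]

theorem primes_neighbourFormation (hΓ : ∀ r ∈ Γ.V, r.Prime) (hp : p ∈ Γ.V) :
    (neighbourFormation.{u} Γ p).primes = Γ.closedNeighbors p := by
  ext q
  refine ⟨fun ⟨G, _, hG, hq⟩ => (mem_neighbourFormation_iff.1 hG).2.2 hq, fun hq => ?_⟩
  obtain ⟨G, _, hG, hGq⟩ :=
    exists_primesOf_eq_singleton.{u} (hΓ q (PrimeGraph.closedNeighbors_subset hp hq))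
  exact ⟨G, _, mem_neighbourFormation_iff.2 ⟨hp, hG, by simpa [hGq] using hq⟩, by simp [hGq]⟩

theorem mem_of_mem_primes_neighbourFormation (h : q ∈ (neighbourFormation.{u} Γ p).primes) :
    p ∈ Γ.V :=
  have ⟨_, _, hG, _⟩ := h
  (mem_neighbourFormation_iff.1 hG).1

theorem mem_localFormation_neighbourFormation_iff {G : Type u} [Group G] [Finite G] :
    (localFormation (neighbourFormation Γ)).Mem G ↔
      Group.IsSolvable G ∧ primesOf G ⊆ Γ.V ∧ ∀ (p q : ℕ) [Fact p.Prime] [Fact q.Prime], p ≠ q →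
        (p, q) ∉ Γ.E → CentralizesChiefFactors p q G := by
  constructor
  · rintro ⟨-, h⟩
    have h' (H K : Subgroup G) [H.Normal] [K.Normal] (hHK : IsChiefFactor H K) {p : ℕ}
        (hp : p.Prime) (hd : p ∣ K.relIndex H) :=
      mem_neighbourFormation_iff.1 (h H K hHK p (mem_primesOf_iff.2 ⟨hp, hd⟩))
    refine ⟨isSolvable_of_chiefFactor fun H K _ _ hHK => ?_, fun p hp => ?_,
      fun p q hp hq hpq hE H K _ _ hHK hd hd' => ?_⟩
    · obtain ⟨p, hp, hd⟩ := Nat.exists_prime_and_dvd (mt relIndex_eq_one.1 hHK.lt.not_ge)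
      exact (h' H K hHK hp hd).2.1.2
    · obtain ⟨hp, hd⟩ := mem_primesOf_iff.1 hp
      obtain ⟨H, K, hHK, hd'⟩ := exists_isChiefFactor_dvd_relIndex hp hd
      have := hHK.normal_top
      have := hHK.normal_bot
      exact (h' H K hHK hp hd').1
    · exact ((h' H K hHK hp.out hd).2.2 (mem_primesOf_iff.2 ⟨hq.out, hd'⟩)).elim hpq.symm hE
  · rintro ⟨hs, hV, hE⟩
    refine ⟨‹_›, fun H K _ _ hHK p hp => mem_neighbourFormation_iff.2
      ⟨hV ?_, ⟨inferInstance, inferInstance⟩, fun q hq => ?_⟩⟩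
    · exact primesOf_subset_of_dvd ((card_quotient_dvd_card _).trans (card_subgroup_dvd_card H)) hp
    · obtain ⟨hp, hd⟩ := mem_primesOf_iff.1 hp
      obtain ⟨hq, hd'⟩ := mem_primesOf_iff.1 hq
      have : Fact p.Prime := ⟨hp⟩
      have : Fact q.Prime := ⟨hq⟩
      by_contra hnot
      obtain ⟨hpq, hpq'⟩ := not_or.1 hnot
      exact hE p q (Ne.symm hpq) hpq' H K hHK hd hd'

end NeighbourFormation

variable {𝔛 : GroupClass.{u}}

theorem sylowClosure_inter_soluble_eq_localFormation (h𝔛 : 𝔛.sylowGraph.IsUndirected) :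
    𝔛.sylowClosure.inter soluble = localFormation (neighbourFormation 𝔛.sylowGraph) := by
  refine ext_mem fun G _ => ⟨?_, fun hG => ?_⟩
  · rintro ⟨hG, _, _⟩
    exact mem_localFormation_neighbourFormation_iff.2 ⟨‹_›, (mem_sylowClosure_iff.1 hG).1,
      fun _ _ _ _ => centralizesChiefFactors_of_mem_sylowClosure h𝔛 hG⟩
  · have := hG.1
    obtain ⟨hs, hV, hE⟩ := mem_localFormation_neighbourFormation_iff.1 hG
    exact ⟨mem_sylowClosure_iff.2 ⟨hV, fun p q _ _ hpq hpq' =>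
      (hE p q hpq hpq').notMem_sylowGraph_of_injective hpq Function.injective_id
        (f := MonoidHom.id G)⟩, ‹_›, hs⟩

theorem primes_sylowClosure_inter_soluble :
    (𝔛.sylowClosure.inter soluble).primes = 𝔛.sylowGraph.V := by
  ext p
  refine ⟨fun ⟨_, _, ⟨⟨_, hV, _⟩, _⟩, hp⟩ => hV hp, fun hp => ?_⟩
  obtain ⟨G, _, hG, hGp⟩ := exists_primesOf_eq_singleton.{u} (prime_of_mem_sylowGraph hp)
  have := hG.1
  refine ⟨G, _, ⟨mem_sylowClosure_iff.2 ⟨by simpa [hGp] using hp, fun r s _ _ hrs _ h => ?_⟩, hG⟩,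
    by simp [hGp]⟩
  have hr : r ∈ primesOf G := (_root_.sylowGraph G).left_mem _ h
  have hs : s ∈ primesOf G := (_root_.sylowGraph G).right_mem _ h
  rw [hGp] at hr hs
  exact hrs (hr.trans hs.symm)

theorem isCoveringFormation_sylowClosure_inter_soluble (h𝔛 : 𝔛.sylowGraph.IsUndirected) :
    (𝔛.sylowClosure.inter soluble).IsCoveringFormation := by
  have hprimes {p : ℕ} (hp : p ∈ 𝔛.sylowGraph.V) :=
    primes_neighbourFormation.{u} (fun _ => prime_of_mem_sylowGraph) hp
  refine ⟨neighbourFormation 𝔛.sylowGraph, fun p _ => isFormation_neighbourFormation,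
    sylowClosure_inter_soluble_eq_localFormation h𝔛, ?_, ?_, fun p q _ _ hpq => ?_⟩
  · rw [primes_sylowClosure_inter_soluble]
    intro p hp
    rw [hprimes hp]
    exact ⟨neighbourFormation_of_mem hp, Or.inl rfl⟩
  · rw [primes_sylowClosure_inter_soluble]
    exact fun p _ hp => neighbourFormation_of_notMem hp
  · have hq := mem_of_mem_primes_neighbourFormation hpq
    rw [hprimes hq] at hpq
    rw [hprimes (PrimeGraph.closedNeighbors_subset hq hpq)]
    exact h𝔛.mem_closedNeighbors_comm.1 hpq

end GroupClass

theorem theorem4p6 (𝔛 : GroupClass.{u}) (h𝔛 : 𝔛.sylowGraph.IsUndirected) :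
    (𝔛.sylowClosure.inter GroupClass.soluble).IsCoveringFormation ∧
    (𝔛.sylowClosure.inter GroupClass.soluble).IsFormation ∧
    (𝔛.sylowClosure.inter GroupClass.soluble).IsHereditary ∧
    (𝔛.sylowClosure.inter GroupClass.soluble).IsSaturated :=
  ⟨GroupClass.isCoveringFormation_sylowClosure_inter_soluble h𝔛,
    GroupClass.isFormation_sylowClosure.inter GroupClass.isFormation_soluble,
    GroupClass.isHereditary_sylowClosure_inter_soluble h𝔛,
    GroupClass.isSaturated_sylowClosure_inter_soluble h𝔛⟩
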